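/- Let $k\ge 0$ and $\ell\ge 1$ be constant integers and let $q:\mathbb N\to\mathbb N$ satisfy $q(n)\ge 1$ and $q(n)=O(\mathrm{poly}(n))$. Write $\Sigma_q=\{0,\dots,q-1\}$, let $\log$ be the logarithm to base $2$, and call the insertion, the deletion or the substitution of one symbol an edit. Then there are a constant $C$ and a polynomial $T$, depending only on $k$, $\ell$ and the function $q$, such that for every $n\ge 3$ there are an integer $\rho\ge 0$ with $$\rho\le \Bigl(3+\frac1\ell\Bigr)k\log n+\Bigl(3+\frac1\ell\Bigr)k\log q(n)+C\log\log n,$$ a syndrome function $\Phi:\Sigma_{q(n)}^n\to\{0,1\}^{\rho}$, and a list decoder $\mathrm{Dec}$ that maps each pair $(y,s)$ with $y\in\Sigma_{q(n)}^*$ and $s\in\{0,1\}^\rho$ to a list of $\ell$ (not necessarily distinct) strings in $\Sigma_{q(n)}^n$, with the following properties. 1. If $y$ is obtained from $x\in\Sigma_{q(n)}^n$ by at most $k$ edits, then $x$ occurs in the list $\mathrm{Dec}(y,\Phi(x))$. 2. Both $\Phi$ and $\mathrm{Dec}$ (on strings $y$ of length at most $n+k$ and all $s\in\{0,1\}^\rho$)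 are computable in time $\mathrm{poly}(n)$: on inputs and outputs written in binary, each is computed by a Boolean circuit for this $n$ (gates: constants, NOT, AND, OR, of fan-in at most two) with at most $T(n)$ gates. Polynomial time is thus meant in the non-uniform sense: the code for each $n$ is only claimed to exist, and the algorithm for length $n$ may have polynomially many bits of information about it built in. -/

import Mathlib

namespace EditCode

/-- One edit applied to a string over the alphabet `α`: the insertion of a symbol, the deletion of
a symbol, or the substitution of a symbol, at any position. -/
inductive Edit {α : Type} : List α → List α → Prop
  | insertion (u v : List α) (a : α) : Edit (u ++ v) (u ++ a :: v)
  | deletion (u v : List α) (a : α) : Edit (u ++ a :: v) (u ++ v)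
  | substitution (u v : List α) (a b : α) : Edit (u ++ a :: v) (u ++ b :: v)

/-- `Edits k x y`: the string `y` is obtained from `x` by a sequence of at most `k` edits. -/
inductive Edits {α : Type} : ℕ → List α → List α → Prop
  | refl (k : ℕ) (x : List α) : Edits k x x
  | step {k : ℕ} {x y z : List α} : Edits k x y → Edit y z → Edits (k + 1) x z

/-- A gate of a Boolean circuit. Wires are numbered by natural numbers. -/
inductive Gate
  | const (b : Bool) : Gate
  | neg (i : ℕ) : Gate
  | conj (i j : ℕ) : Gate
  | disj (i j : ℕ) : Gate

/-- The value of a gate, given the list `w` of the values of all earlier wires (a reference to a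
wire that does not exist reads `false`). -/
def Gate.eval (w : List Bool) : Gate → Bool
  | .const b => b
  | .neg i => !(w.getD i false)
  | .conj i j => w.getD i false && w.getD j false
  | .disj i j => w.getD i false || w.getD j false

/-- A Boolean circuit of fan-in at most two, with gates in topological order. The first wires carry
the input bits, in order; each gate then adds one wire, computed from earlier wires. The output is
read off from the listed wires. -/
structure Circuit where
  gates : List Gate
  outputs : List ℕ

/-- The number of elementary Boolean operations performed by the circuit. -/
def Circuit.size (C : Circuit) : ℕ := C.gates.length

/-- The output bits of the circuit on the given input bits. -/
def Circuit.eval (C : Circuit) (input : List Bool) : List Bool :=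
  C.outputs.map fun i =>
    (C.gates.foldl (fun w g => w ++ [g.eval w]) input).getD i false

/-- The bits of one slot of a word over the alphabet `{0, …, q - 1}`: a presence bit, followed by
`⌈log₂ q⌉` bits holding the binary digits of the symbol (all bits are `false` in a blank slot). -/
def slotBits (q : ℕ) : Option (Fin q) → List Bool
  | none => List.replicate (1 + Nat.clog 2 q) false
  | some a => true :: (List.range (Nat.clog 2 q)).map fun j => a.val.testBit j

/-- The bits of a word `y` of length at most `L`, written into `L` slots (unused slots are
blank). -/
def wordBits (q L : ℕ) (y : List (Fin q)) : List Bool :=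
  (List.range L).flatMap fun i => slotBits q y[i]?

end EditCode

namespace EditCode

section Derivations

/-! ### Derivations of Boolean functions by gates -/

/-- All wires of a list of gates started on the wires `w`. -/
def runGates (G : List Gate) (w : List Bool) : List Bool :=
  G.foldl (fun w g => w ++ [g.eval w]) w

theorem runGates_append (G H : List Gate) (w : List Bool) :
    runGates (G ++ H) w = runGates H (runGates G w) := by
  simp [runGates]

theorem length_runGates (G : List Gate) (w : List Bool) :
    (runGates G w).length = w.length + G.length := by
  induction G generalizing w with
  | nil => simp [runGates]
  | cons g G ih =>
    have := ih (w ++ [g.eval w])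
    simp only [runGates, List.foldl_cons, List.length_append, List.length_cons,
      List.length_nil] at this ⊢
    omega

theorem prefix_runGates (G : List Gate) (w : List Bool) : w <+: runGates G w := by
  induction G generalizing w with
  | nil => simp [runGates]
  | cons g G ih => exact (List.prefix_append _ _).trans (ih (w ++ [g.eval w]))

variable {D ι : Type*} {N : ℕ} {e : D → List.Vector Bool N}

/-- Some wire of the circuit with gates `G` carries the Boolean function `b` of the input. -/
def Computes (e : D → List.Vector Bool N) (G : List Gate) (b : D → Bool) : Prop :=
  ∃ i : ℕ, ∀ d, (runGates G (e d).toList)[i]? = some (b d)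

theorem Computes.append {G : List Gate} {b : D → Bool} (h : Computes e G b) (H : List Gate) :
    Computes e (G ++ H) b := by
  obtain ⟨i, hi⟩ := h
  refine ⟨i, fun d => ?_⟩
  rw [runGates_append]
  obtain ⟨t, ht⟩ := prefix_runGates H (runGates G (e d).toList)
  have hlt := (List.getElem?_eq_some_iff.1 (hi d)).1
  rw [← ht, List.getElem?_append_left hlt, hi d]

theorem Computes.snoc {G : List Gate} {b : D → Bool} (g : Gate)
    (h : ∀ d, g.eval (runGates G (e d).toList) = b d) : Computes e (G ++ [g]) b := by
  refine ⟨N + G.length, fun d => ?_⟩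
  have hl : (runGates G (e d).toList).length = N + G.length := by
    rw [length_runGates, List.Vector.toList_length]
  rw [runGates_append]
  simp [runGates] at hl h ⊢
  rw [List.getElem?_append_right (by omega)]
  simp [hl, h]

/-- Whenever the functions in `A` are available, those in `B` can be made available with at most
`c` further gates. -/
def Derivable (e : D → List.Vector Bool N) (A B : Set (D → Bool)) (c : ℕ) : Prop :=
  ∀ G, (∀ b ∈ A, Computes e G b) → ∃ H, H.length ≤ c ∧ ∀ b ∈ B, Computes e (G ++ H) b

variable {A A' B B' : Set (D → Bool)} {c c' : ℕ} {f g : D → Bool}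

theorem Derivable.mono (h : Derivable e A B c) (hA : A ⊆ A') (hB : B' ⊆ B) (hc : c ≤ c') :
    Derivable e A' B' c' := fun G hG =>
  let ⟨H, h1, h2⟩ := h G fun b hb => hG b (hA hb)
  ⟨H, h1.trans hc, fun b hb => h2 b (hB hb)⟩

theorem Derivable.le (h : Derivable e A B c) (hc : c ≤ c') : Derivable e A B c' :=
  h.mono subset_rfl subset_rfl hc

theorem Derivable.of_subset (h : B ⊆ A) : Derivable e A B 0 := fun G hG =>
  ⟨[], le_rfl, fun b hb => (List.append_nil G).symm ▸ hG b (h hb)⟩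

theorem Derivable.of_mem (h : f ∈ A) : Derivable e A {f} 0 :=
  .of_subset (by simpa using h)

theorem Derivable.trans {C : Set (D → Bool)} (h : Derivable e A B c) (h' : Derivable e B C c') :
    Derivable e A C (c + c') := fun G hG => by
  obtain ⟨H, h1, h2⟩ := h G hG
  obtain ⟨H', h3, h4⟩ := h' _ h2
  exact ⟨H ++ H', by simpa using Nat.add_le_add h1 h3, fun b hb =>
    List.append_assoc G H H' ▸ h4 b hb⟩

theorem Derivable.union {C : Set (D → Bool)} (h : Derivable e A B c) (h' : Derivable e A C c') :
    Derivable e A (B ∪ C) (c + c') := fun G hG => by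
  obtain ⟨H, h1, h2⟩ := h G hG
  obtain ⟨H', h3, h4⟩ := h' (G ++ H) fun b hb => (hG b hb).append H
  refine ⟨H ++ H', by simpa using Nat.add_le_add h1 h3, ?_⟩
  rw [← List.append_assoc]
  rintro b (hb | hb)
  exacts [(h2 b hb).append H', h4 b hb]

theorem Derivable.iUnion [Fintype ι] {B : ι → Set (D → Bool)}
    (h : ∀ i, Derivable e A (B i) c) : Derivable e A (⋃ i, B i) (Fintype.card ι * c) := by
  classical
  have key : ∀ s : Finset ι, Derivable e A (⋃ i ∈ s, B i) (s.card * c) := by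
    intro s
    induction s using Finset.induction_on with
    | empty => simpa using Derivable.of_subset (Set.empty_subset A)
    | insert a s ha ih =>
      rw [Finset.set_biUnion_insert, Finset.card_insert_of_notMem ha, add_mul, one_mul, add_comm]
      exact (h a).union ih
  simpa using key Finset.univ

theorem Derivable.range [Fintype ι] {b : ι → D → Bool}
    (h : ∀ i, Derivable e A {b i} c) : Derivable e A (Set.range b) (Fintype.card ι * c) := by
  have := Derivable.iUnion h
  rwa [Set.iUnion_singleton_eq_range] at this

theorem Derivable.const (b : Bool) : Derivable e A {fun _ => b} 1 := fun G _ =>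
  ⟨[.const b], le_rfl, by rintro _ rfl; exact .snoc _ fun d => rfl⟩

theorem Derivable.not_gate : Derivable e {f} {fun d => !f d} 1 := fun G hG => by
  obtain ⟨i, hi⟩ := hG f rfl
  exact ⟨[.neg i], le_rfl, by rintro _ rfl; exact .snoc _ fun d => by simp [Gate.eval, hi]⟩

theorem Derivable.and_gate : Derivable e {f, g} {fun d => f d && g d} 1 := fun G hG => by
  obtain ⟨i, hi⟩ := hG f (by simp)
  obtain ⟨j, hj⟩ := hG g (by simp)
  exact ⟨[.conj i j], le_rfl, by rintro _ rfl; exact .snoc _ fun d => by simp [Gate.eval, hi, hj]⟩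

theorem Derivable.or_gate : Derivable e {f, g} {fun d => f d || g d} 1 := fun G hG => by
  obtain ⟨i, hi⟩ := hG f (by simp)
  obtain ⟨j, hj⟩ := hG g (by simp)
  exact ⟨[.disj i j], le_rfl, by rintro _ rfl; exact .snoc _ fun d => by simp [Gate.eval, hi, hj]⟩

theorem Derivable.not (h : Derivable e A {f} c) : Derivable e A {fun d => !f d} (c + 1) :=
  h.trans .not_gate

theorem Derivable.pair (h : Derivable e A {f} c) (h' : Derivable e A {g} c') :
    Derivable e A {f, g} (c + c') := h.union h'

theorem Derivable.and (h : Derivable e A {f} c) (h' : Derivable e A {g} c') :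
    Derivable e A {fun d => f d && g d} (c + c' + 1) := (h.pair h').trans .and_gate

theorem Derivable.or (h : Derivable e A {f} c) (h' : Derivable e A {g} c') :
    Derivable e A {fun d => f d || g d} (c + c' + 1) := (h.pair h').trans .or_gate

theorem Derivable.xor (h : Derivable e A {f} c) (h' : Derivable e A {g} c') :
    Derivable e A {fun d => f d ^^ g d} (c + c' + 4) := by
  have hf : Derivable e {f, g} {f} 0 := .of_mem (by simp)
  have hg : Derivable e {f, g} {g} 0 := .of_mem (by simp)
  have key := (h.pair h').trans ((hf.or hg).and (hf.and hg).not)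
  refine key.mono subset_rfl ?_ le_rfl
  rintro _ rfl
  funext d
  cases f d <;> cases g d <;> rfl

theorem Derivable.exists [Fintype ι] {b : ι → D → Bool} (hb : ∀ i, Derivable e A {b i} c)
    (hf : ∀ d, f d = true ↔ ∃ i, b i d = true) :
    Derivable e A {f} (Fintype.card ι * (c + 1) + 1) := by
  classical
  have key : ∀ s : Finset ι, Derivable e A {fun d => decide (∃ i ∈ s, b i d = true)}
      (s.card * (c + 1) + 1) := by
    intro s
    induction s using Finset.induction_on with
    | empty => simpa using Derivable.const false
    | insert a s ha ih =>
      rw [Finset.card_insert_of_notMem ha]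
      refine ((hb a).or ih).mono subset_rfl ?_ (by ring_nf; omega)
      rintro _ rfl
      funext d
      simp [Bool.decide_or]
  refine (key Finset.univ).mono subset_rfl ?_ (by simp)
  rintro _ rfl
  funext d
  rw [Bool.eq_iff_iff, hf]
  simp

theorem Derivable.forall [Fintype ι] {b : ι → D → Bool} (hb : ∀ i, Derivable e A {b i} c)
    (hf : ∀ d, f d = true ↔ ∀ i, b i d = true) :
    Derivable e A {f} (Fintype.card ι * (c + 2) + 2) := by
  have h := (Derivable.exists (f := fun d => !f d) (fun i => (hb i).not) fun d => by
    rw [Bool.not_eq_true', ← Bool.not_eq_true, hf]; simp).not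
  simpa using h

theorem Derivable.sum [Fintype ι] {b : ι → D → ZMod 2}
    (hb : ∀ i, Derivable e A {fun d => decide (b i d = 1)} c) :
    Derivable e A {fun d => decide (∑ i, b i d = 1)} (Fintype.card ι * (c + 4) + 1) := by
  classical
  have key : ∀ s : Finset ι, Derivable e A {fun d => decide (∑ i ∈ s, b i d = 1)}
      (s.card * (c + 4) + 1) := by
    intro s
    induction s using Finset.induction_on with
    | empty => simpa using Derivable.const false
    | insert a s ha ih =>
      rw [Finset.card_insert_of_notMem ha]
      refine ((hb a).xor ih).mono subset_rfl ?_ (by ring_nf; omega)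
      rintro _ rfl
      funext d
      rw [Finset.sum_insert ha]
      generalize b a d = u
      generalize ∑ i ∈ s, b i d = v
      revert u v
      decide
  simpa using key Finset.univ

theorem Derivable.find (l : List ι) {p v : ι → D → Bool} {c₁ c₂ c₃ : ℕ}
    (hp : ∀ i, Derivable e A {p i} c₁) (hv : ∀ i, Derivable e A {v i} c₂)
    (hg : Derivable e A {g} c₃) :
    Derivable e A {fun d => ((l.find? fun i => p i d).map fun i => v i d).getD (g d)}
      (l.length * (2 * c₁ + c₂ + 4) + c₃) := by
  induction l with
  | nil => simpa using hg
  | cons a l ih =>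
    refine (((hp a).and (hv a)).or ((hp a).not.and ih)).mono subset_rfl ?_
      (by rw [List.length_cons]; ring_nf; omega)
    rintro _ rfl
    funext d
    rw [List.find?_cons]
    cases p a d <;> simp

/-- One-hot availability of `v` makes every predicate of `v` available. -/
theorem Derivable.comp {V : Type*} [Fintype V] [DecidableEq V] {v : D → V}
    (hv : ∀ a, (fun d => decide (v d = a)) ∈ A) (P : V → Bool) :
    Derivable e A {fun d => P (v d)} (Fintype.card V + 1) := by
  have h := Derivable.exists (e := e) (ι := {a // P a = true}) (f := fun d => P (v d))
    (fun a => Derivable.of_mem (hv a)) (fun d => by simp)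
  refine h.le ?_
  have := Fintype.card_subtype_le fun a => P a = true
  omega

/-- A circuit for finitely many derivable output bits, arranged in an arbitrary order. -/
theorem Derivable.exists_circuit {out : D → List Bool}
    (hA : ∀ b ∈ A, ∃ i : ℕ, ∀ d, (e d).toList[i]? = some (b d)) (h : Derivable e A B c)
    (bits : List (D → Bool)) (hbits : ∀ b ∈ bits, b ∈ B)
    (hout : ∀ d, out d = bits.map fun b => b d) :
    ∃ C : Circuit, C.size ≤ c ∧ ∀ d, C.eval (e d).toList = out d := by
  obtain ⟨G, hG, hB⟩ := h [] fun b hb => hA b hb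
  choose! idx hidx using hB
  refine ⟨⟨G, bits.map idx⟩, hG, fun d => ?_⟩
  rw [hout]
  simp only [Circuit.eval, List.map_map]
  refine List.map_congr_left fun b hb => ?_
  have := hidx b (hbits b hb) d
  simp only [List.nil_append, runGates] at this
  simp [this]

end Derivations

section Operations

/-! ### Edit operations at explicit positions -/

variable {α : Type}

theorem Edit.symm {x y : List α} (h : Edit x y) : Edit y x := by
  cases h with
  | insertion u v a => exact .deletion u v a
  | deletion u v a => exact .insertion u v a
  | substitution u v a b => exact .substitution u v b a

theorem Edit.length_le {x y : List α} (h : Edit x y) : y.length ≤ x.length + 1 := by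
  cases h <;> simp <;> omega

theorem Edits.length_le {k : ℕ} {x y : List α} (h : Edits k x y) :
    y.length ≤ x.length + k := by
  induction h with
  | refl => omega
  | step _ h ih => have := h.length_le; omega

/-- An edit operation: a position, a symbol, and the kind of the operation (insertion, deletion,
substitution, no change). -/
abbrev Op (M : ℕ) (α : Type) := Fin M × α × Fin 4

/-- The word after an edit operation. -/
def Op.apply {M : ℕ} (o : Op M α) (w : List α) : List α :=
  match o.2.2 with
  | 0 => w.insertIdx o.1 o.2.1
  | 1 => w.eraseIdx o.1
  | 2 => w.set o.1 o.2.1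
  | 3 => w

/-- The word after a sequence of edit operations. -/
def applyOps {M : ℕ} (l : List (Op M α)) (w : List α) : List α :=
  l.foldl (fun w o => o.apply w) w

theorem applyOps_append {M : ℕ} (l l' : List (Op M α)) (w : List α) :
    applyOps (l ++ l') w = applyOps l' (applyOps l w) := by
  simp [applyOps]

theorem Op.length_apply_le {M : ℕ} (o : Op M α) (w : List α) :
    (o.apply w).length ≤ w.length + 1 := by
  rw [Op.apply]
  split
  · rw [List.length_insertIdx]; split <;> omega
  · rw [List.length_eraseIdx]; split <;> omega
  · simp
  · simp

theorem length_applyOps_le {M : ℕ} (l : List (Op M α)) (w : List α) :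
    (applyOps l w).length ≤ w.length + l.length := by
  induction l generalizing w with
  | nil => simp [applyOps]
  | cons o l ih =>
    have h1 := ih (o.apply w)
    have h2 := o.length_apply_le w
    simp only [applyOps, List.foldl_cons, List.length_cons] at h1 ⊢
    omega

/-- Each symbol of the new word depends on a single symbol of the old word. -/
theorem Op.getElem?_apply {M : ℕ} (o : Op M α) (j : ℕ) :
    ∃ (i : ℕ) (φ : Option α → Option α), ∀ w, (o.apply w)[j]? = φ w[i]? := by
  obtain ⟨p, a, t⟩ := o
  fin_cases t
  · rcases lt_trichotomy j p with h | h | h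
    · exact ⟨j, id, fun w => by simp [Op.apply, List.getElem?_insertIdx, h]⟩
    · rcases Nat.eq_zero_or_pos j with h0 | h0
      · exact ⟨0, fun _ => some a, fun w => by
          simp [Op.apply, ← h, h0]⟩
      · refine ⟨j - 1, fun s => s.map fun _ => a, fun w => ?_⟩
        rcases le_or_gt j w.length with hl | hl
        · have : j - 1 < w.length := by omega
          simp [Op.apply, List.getElem?_insertIdx, ← h, hl, this]
        · have : w.length ≤ j - 1 := by omega
          simp [Op.apply, List.getElem?_insertIdx, ← h, hl, this]
    · exact ⟨j - 1, id, fun w => by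
        simp [Op.apply, List.getElem?_insertIdx, h.not_gt, h.ne']⟩
  · rcases lt_or_ge j p with h | h
    · exact ⟨j, id, fun w => by simp [Op.apply, List.getElem?_eraseIdx, h]⟩
    · exact ⟨j + 1, id, fun w => by simp [Op.apply, List.getElem?_eraseIdx, h.not_gt]⟩
  · by_cases h : (p : ℕ) = j
    · exact ⟨j, fun s => s.map fun _ => a, fun w => by
        simp [Op.apply, List.getElem?_set, h]
        split <;> simp_all⟩
    · exact ⟨j, id, fun w => by simp [Op.apply, h]⟩
  · exact ⟨j, id, fun w => rfl⟩

theorem getElem?_applyOps {M : ℕ} (l : List (Op M α)) (j : ℕ) :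
    ∃ (i : ℕ) (φ : Option α → Option α), ∀ w, (applyOps l w)[j]? = φ w[i]? := by
  induction l with
  | nil => exact ⟨j, id, fun w => rfl⟩
  | cons o l ih =>
    obtain ⟨i, φ, h⟩ := ih
    obtain ⟨i', ψ, h'⟩ := o.getElem?_apply i
    exact ⟨i', φ ∘ ψ, fun w => by
      simpa [applyOps, h'] using h (o.apply w)⟩

theorem Edit.exists_op {M : ℕ} [Nonempty α] {x y : List α} (h : Edit x y) (hM : x.length < M) :
    ∃ o : Op M α, o.apply x = y := by
  cases h with
  | insertion u v a =>
    refine ⟨(⟨u.length, by simp at hM; omega⟩, a, 0), ?_⟩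
    show (u ++ v).insertIdx u.length a = u ++ a :: v
    clear hM
    induction u with
    | nil => simp
    | cons b u ih => simpa using ih
  | deletion u v a =>
    refine ⟨(⟨u.length, by simp at hM; omega⟩, a, 1), ?_⟩
    simp [Op.apply, List.eraseIdx_append_of_length_le]
  | substitution u v a b =>
    refine ⟨(⟨u.length, by simp at hM; omega⟩, b, 2), ?_⟩
    simp [Op.apply]

theorem exists_applyOps_eq_self {M : ℕ} [NeZero M] [Nonempty α] (k : ℕ) (x : List α) :
    ∃ l : List.Vector (Op M α) k, applyOps l.toList x = x := by
  refine ⟨.replicate k (0, Classical.arbitrary α, 3), ?_⟩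
  induction k with
  | zero => rfl
  | succ k ih => exact ih

theorem Edits.exists_ops {M k : ℕ} [Nonempty α] {x y : List α} (h : Edits k x y)
    (hM : x.length + k < M) : ∃ l : List.Vector (Op M α) k, applyOps l.toList x = y := by
  have : NeZero M := ⟨by omega⟩
  induction h with
  | refl k x => exact exists_applyOps_eq_self k x
  | step h h' ih =>
    obtain ⟨l, hl⟩ := ih (by omega)
    obtain ⟨o, ho⟩ := h'.exists_op (M := M) (by have := h.length_le; omega)
    refine ⟨⟨l.toList ++ [o], by simp⟩, ?_⟩
    rw [List.Vector.toList_mk, applyOps_append, hl]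
    exact ho

theorem Edits.exists_ops_symm {M k : ℕ} [Nonempty α] {x y : List α} (h : Edits k x y)
    (hM : x.length + k < M) : ∃ l : List.Vector (Op M α) k, applyOps l.toList y = x := by
  have : NeZero M := ⟨by omega⟩
  induction h with
  | refl k x => exact exists_applyOps_eq_self k x
  | step h h' ih =>
    obtain ⟨l, hl⟩ := ih (by omega)
    have := h.length_le
    have := h'.length_le
    obtain ⟨o, ho⟩ := h'.symm.exists_op (M := M) (by omega)
    refine ⟨⟨o :: l.toList, by simp⟩, ?_⟩
    rw [List.Vector.toList_mk, applyOps, List.foldl_cons, ho]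
    exact hl

end Operations

section Hashes

/-! ### Random table hashes -/

/-- If each point is bad for at most half of the labels, then some family of labels contains for
each point a label for which it is not bad, as soon as `2` to the size of the family exceeds the
number of points. -/
theorem exists_family_not_bad {X A ι : Type*} [Fintype X] [Fintype A] [Fintype ι] [Nonempty A]
    (bad : A → X → Prop)
    (hbad : ∀ x, 2 * Nat.card {a // bad a x} ≤ Nat.card A)
    (hcard : Fintype.card X < 2 ^ Fintype.card ι) :
    ∃ s : ι → A, ∀ x, ∃ i, ¬ bad (s i) x := by
  classical
  by_contra! hcon
  have hsub : (Finset.univ : Finset (ι → A)) ⊆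
      Finset.univ.biUnion fun x : X => Fintype.piFinset fun _ : ι => {a | bad a x} := by
    intro s _
    obtain ⟨x, hx⟩ := hcon s
    simpa using ⟨x, hx⟩
  have h1 := (Finset.card_le_card hsub).trans Finset.card_biUnion_le
  simp only [Fintype.card_piFinset, Finset.prod_const, Finset.card_univ, Fintype.card_fun] at h1
  have hpos : 0 < Fintype.card A ^ Fintype.card ι := pow_pos Fintype.card_pos _
  have h2 : 2 ^ Fintype.card ι * Fintype.card A ^ Fintype.card ι ≤
      Fintype.card X * Fintype.card A ^ Fintype.card ι := by
    calc _ ≤ 2 ^ Fintype.card ι *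
          ∑ x : X, (Finset.univ.filter fun a => bad a x).card ^ Fintype.card ι :=
          Nat.mul_le_mul_left _ h1
      _ = ∑ x : X, (2 * (Finset.univ.filter fun a => bad a x).card) ^ Fintype.card ι := by
          simp_rw [mul_pow, Finset.mul_sum]
      _ ≤ ∑ _x : X, Fintype.card A ^ Fintype.card ι := by
          refine Finset.sum_le_sum fun x _ => Nat.pow_le_pow_left ?_ _
          have := hbad x
          rwa [Nat.card_eq_fintype_card, Nat.card_eq_fintype_card, Fintype.card_subtype] at this
      _ = _ := by simp
  exact absurd (Nat.le_of_mul_le_mul_right h2 hpos) (not_le.2 hcard)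

variable {α : Type} {L : ℕ}

/-- The sum of the entries that a word selects from a table. -/
def wordSum (T : Fin L → Option α → ZMod 2) (w : List α) : ZMod 2 := ∑ i : Fin L, T i w[i]?

theorem exists_getElem?_ne {w w' : List α} (h : w ≠ w') (hw : w.length ≤ L)
    (hw' : w'.length ≤ L) : ∃ i : Fin L, w[i]? ≠ w'[i]? := by
  by_contra! hcon
  refine h (List.ext_getElem? fun i => ?_)
  rcases lt_or_ge i L with hi | hi
  · exact hcon ⟨i, hi⟩
  · rw [List.getElem?_eq_none (by omega), List.getElem?_eq_none (by omega)]

/-- Different words have the same sum for at most half of the tables. -/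
theorem two_mul_card_wordSum_eq_le [Fintype α] {w w' : List α} (h : w ≠ w')
    (hw : w.length ≤ L) (hw' : w'.length ≤ L) :
    2 * Nat.card {T : Fin L → Option α → ZMod 2 // wordSum T w = wordSum T w'} ≤
      Nat.card (Fin L → Option α → ZMod 2) := by
  classical
  obtain ⟨i, hi⟩ := exists_getElem?_ne h hw hw'
  let t : Fin L → Option α → ZMod 2 := Pi.single i (Pi.single w[i]? 1)
  have hadd : ∀ T v, wordSum (T + t) v = wordSum T v + wordSum t v := fun T v => by
    simp [wordSum, Finset.sum_add_distrib]
  have ht : ∀ v : List α, wordSum t v = if v[i]? = w[i]? then 1 else 0 := fun v => by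
    rw [wordSum, Finset.sum_eq_single i]
    · simp [t, Pi.single_apply]
    · intro j _ hj; simp [t, Pi.single_eq_of_ne hj]
    · simp
  have hle : Nat.card {T : Fin L → Option α → ZMod 2 // wordSum T w = wordSum T w'} ≤
      Nat.card {T : Fin L → Option α → ZMod 2 // ¬ wordSum T w = wordSum T w'} := by
    refine Nat.card_le_card_of_injective
      (fun T => ⟨T.1 + t, by simpa [hadd, ht, T.2] using Ne.symm hi⟩) fun T T' hT => ?_
    simpa [Subtype.ext_iff] using hT
  have hsum : Nat.card {T : Fin L → Option α → ZMod 2 // wordSum T w = wordSum T w'} +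
      Nat.card {T : Fin L → Option α → ZMod 2 // ¬ wordSum T w = wordSum T w'} =
      Nat.card (Fin L → Option α → ZMod 2) := by
    rw [← Nat.card_sum]
    exact Nat.card_congr (Equiv.sumCompl _)
  omega

theorem two_pow_mul_card_wordSum_eq_le [Fintype α] (m : ℕ) {w w' : List α} (h : w ≠ w')
    (hw : w.length ≤ L) (hw' : w'.length ≤ L) :
    2 ^ m * Nat.card {T : Fin m → Fin L → Option α → ZMod 2 //
        ∀ j, wordSum (T j) w = wordSum (T j) w'} ≤
      Nat.card (Fin m → Fin L → Option α → ZMod 2) := by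
  have h1 : Nat.card {T : Fin m → Fin L → Option α → ZMod 2 //
        ∀ j, wordSum (T j) w = wordSum (T j) w'} =
      Nat.card {T : Fin L → Option α → ZMod 2 // wordSum T w = wordSum T w'} ^ m := by
    rw [Nat.card_congr (Equiv.subtypePiEquivPi
      (p := fun _ T => wordSum T w = wordSum T w')), Nat.card_fun, Nat.card_fin]
  rw [h1, Nat.card_fun, ← mul_pow, Nat.card_fin]
  exact Nat.pow_le_pow_left (two_mul_card_wordSum_eq_le h hw hw') m

/-- The family of tables `T` (one for each seed) is good at the word `w` for the seed `s` if no
word obtained by `K` operations, other than `w`, collides with `w`. -/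
def Separates {M m : ℕ} (K : ℕ) (T : Fin m → Fin L → Option α → ZMod 2) (w : List α) : Prop :=
  ∀ p : List.Vector (Op M α) K, applyOps p.toList w ≠ w →
    ∃ j, wordSum (T j) (applyOps p.toList w) ≠ wordSum (T j) w

theorem exists_separating_family [Fintype α] {M m n K : ℕ} {ι : Type*} [Fintype ι]
    (hL : n + K ≤ L) (hm : 2 * Fintype.card (Op M α) ^ K ≤ 2 ^ m)
    (hι : Fintype.card α ^ n < 2 ^ Fintype.card ι) :
    ∃ T : ι → Fin m → Fin L → Option α → ZMod 2, ∀ x : Fin n → α, ∃ s,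
      Separates (M := M) K (T s) (List.ofFn x) := by
  classical
  have key := exists_family_not_bad (X := Fin n → α) (ι := ι)
    (A := Fin m → Fin L → Option α → ZMod 2)
    (fun T x => ¬ Separates (M := M) K T (List.ofFn x)) ?_ (by simpa using hι)
  · simpa using key
  intro x
  set w := List.ofFn x with hw
  have hwl : w.length = n := by simp [hw]
  let Q : List.Vector (Op M α) K → (Fin m → Fin L → Option α → ZMod 2) → Prop := fun p T =>
    applyOps p.toList w ≠ w ∧ ∀ j, wordSum (T j) (applyOps p.toList w) = wordSum (T j) w
  have hQ : ∀ p, 2 ^ m * Nat.card {T // Q p T} ≤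
      Nat.card (Fin m → Fin L → Option α → ZMod 2) := by
    intro p
    by_cases hp : applyOps p.toList w = w
    · simp [Q, hp]
    · have hl := length_applyOps_le p.toList w
      rw [List.Vector.toList_length] at hl
      have h1 := two_pow_mul_card_wordSum_eq_le (L := L) m hp (by omega) (by omega)
      simpa [Q, hp] using h1
  have hunion : Nat.card {T : Fin m → Fin L → Option α → ZMod 2 // ¬ Separates (M := M) K T w} ≤
      ∑ p : List.Vector (Op M α) K, Nat.card {T // Q p T} := by
    simp_rw [Nat.card_eq_fintype_card, Fintype.card_subtype]
    refine le_trans (Finset.card_le_card ?_) Finset.card_biUnion_le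
    intro T hT
    simpa [Separates, Q] using hT
  have h3 : 2 ^ m * Nat.card {T : Fin m → Fin L → Option α → ZMod 2 // ¬ Separates (M := M) K T w} ≤
      Fintype.card (Op M α) ^ K * Nat.card (Fin m → Fin L → Option α → ZMod 2) := by
    calc _ ≤ ∑ p : List.Vector (Op M α) K, 2 ^ m * Nat.card {T // Q p T} := by
          rw [← Finset.mul_sum]; exact Nat.mul_le_mul_left _ hunion
      _ ≤ ∑ _p : List.Vector (Op M α) K, Nat.card (Fin m → Fin L → Option α → ZMod 2) :=
          Finset.sum_le_sum fun p _ => hQ p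
      _ = _ := by simp [card_vector]
  rcases Nat.eq_zero_or_pos (Fintype.card (Op M α) ^ K) with h0 | h0
  · rw [h0, zero_mul] at h3
    have := Nat.pos_of_ne_zero (pow_ne_zero m (two_ne_zero (α := ℕ)))
    have : Nat.card {T : Fin m → Fin L → Option α → ZMod 2 // ¬ Separates (M := M) K T w} = 0 := by
      rcases Nat.mul_eq_zero.1 (Nat.le_zero.1 h3) with h | h <;> omega
    rw [this]; omega
  · refine Nat.le_of_mul_le_mul_left ?_ h0
    refine le_trans ?_ h3
    rw [← mul_assoc, mul_comm _ 2]
    exact Nat.mul_le_mul_right _ hm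

end Hashes

section Reading

/-! ### Circuits reading words -/

section Words

variable {D : Type*} {N : ℕ} {e : D → List.Vector Bool N} {A : Set (D → Bool)}
variable {α : Type} [Fintype α] [DecidableEq α] {w : D → List α} {L M : ℕ}

/-- The indicator functions of the symbols of a word depending on the input. -/
def symbolBits (w : D → List α) : Set (D → Bool) :=
  {b | ∃ (i : ℕ) (o : Option α), b = fun d => decide ((w d)[i]? = o)}

theorem derivable_symbol (hA : symbolBits w ⊆ A) (l : List (Op M α)) (i : ℕ)
    (P : Option α → Bool) :
    Derivable e A {fun d => P (applyOps l (w d))[i]?} (Fintype.card α + 2) := by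
  obtain ⟨j, φ, h⟩ := getElem?_applyOps l i
  simp_rw [h]
  have := Derivable.comp (e := e) (v := fun d => (w d)[j]?) (fun o => hA ⟨j, o, rfl⟩)
    (fun s => P (φ s))
  rwa [Fintype.card_option] at this

theorem derivable_wordSum (hA : symbolBits w ⊆ A) (l : List (Op M α))
    (T : Fin L → Option α → ZMod 2) :
    Derivable e A {fun d => decide (wordSum T (applyOps l (w d)) = 1)}
      (L * (Fintype.card α + 6) + 1) := by
  have := Derivable.sum (ι := Fin L) (b := fun i d => T i (applyOps l (w d))[i]?) fun i =>
    derivable_symbol (e := e) hA l i fun o => decide (T i o = 1)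
  rwa [Fintype.card_fin] at this

theorem not_xor_decide_iff (p q : Prop) [Decidable p] [Decidable q] :
    (!(decide p ^^ decide q)) = true ↔ (p ↔ q) := by
  by_cases hp : p <;> by_cases hq : q <;> simp [hp, hq]

theorem derivable_applyOps_eq (hA : symbolBits w ⊆ A) (l : List (Op M α))
    (hL : ∀ d, (w d).length + l.length ≤ L) :
    Derivable e A {fun d => decide (applyOps l (w d) = w d)}
      (L * (Fintype.card α + 1) * (2 * Fintype.card α + 11) + 2) := by
  have := Derivable.forall (e := e) (A := A) (ι := Fin L × Option α)
    (f := fun d => decide (applyOps l (w d) = w d))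
    (fun io => ((derivable_symbol hA l io.1 fun s => decide (s = io.2)).xor
      (derivable_symbol hA ([] : List (Op M α)) io.1 fun s => decide (s = io.2))).not) ?_
  · refine this.le (le_of_eq ?_)
    rw [Fintype.card_prod, Fintype.card_fin, Fintype.card_option]
    ring
  intro d
  rw [decide_eq_true_iff]
  refine Iff.trans ?_ (forall_congr' fun io => (not_xor_decide_iff _ _).symm)
  refine ⟨fun h io => by rw [h]; rfl, fun h => ?_⟩
  by_contra hne
  have := length_applyOps_le l (w d)
  have := hL d
  obtain ⟨i, hi⟩ := exists_getElem?_ne (L := L) hne (by omega) (by omega)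
  exact hi ((h (i, (w d)[i]?)).2 rfl)

theorem zmod_two_ne_iff (a b : ZMod 2) : a ≠ b ↔ (decide (a = 1) ^^ decide (b = 1)) = true := by
  revert a b
  decide

open Classical in
theorem derivable_separates {m K : ℕ} (hA : symbolBits w ⊆ A)
    (T : Fin m → Fin L → Option α → ZMod 2) (hL : ∀ d, (w d).length + K ≤ L) :
    Derivable e A {fun d => decide (Separates (M := M) K T (w d))}
      ((M * Fintype.card α * 4) ^ K * (L * (Fintype.card α + 1) * (2 * Fintype.card α + 11) +
        m * (2 * (L * (Fintype.card α + 6)) + 7) + 6) + 2) := by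
  have h1 (p : List.Vector (Op M α) K) : Derivable e A
      {fun d => decide (∃ j, wordSum (T j) (applyOps p.toList (w d)) ≠ wordSum (T j) (w d))}
      (m * (2 * (L * (Fintype.card α + 6)) + 7) + 1) := by
    have := Derivable.exists (e := e) (A := A) (ι := Fin m)
      (f := fun d => decide (∃ j, wordSum (T j) (applyOps p.toList (w d)) ≠ wordSum (T j) (w d)))
      (fun j => (derivable_wordSum hA p.toList (T j)).xor
        (derivable_wordSum hA ([] : List (Op M α)) (T j)))
      (fun d => by simp only [decide_eq_true_iff, zmod_two_ne_iff]; rfl)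
    refine this.le (le_of_eq ?_)
    rw [Fintype.card_fin]
    ring
  have := Derivable.forall (e := e) (A := A) (ι := List.Vector (Op M α) K)
    (f := fun d => decide (Separates (M := M) K T (w d)))
    (fun p => (derivable_applyOps_eq (L := L) hA p.toList (by simpa using hL)).or (h1 p))
    (fun d => by
      rw [decide_eq_true_iff]
      simp only [decide_eq_true_iff, Bool.or_eq_true, or_iff_not_imp_left]
      rfl)
  refine this.le (le_of_eq ?_)
  rw [card_vector, Fintype.card_prod, Fintype.card_prod, Fintype.card_fin, Fintype.card_fin]
  ring

end Words

/-! ### The code -/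

section Code

variable {α : Type} {L M r m : ℕ}

/-- The syndrome of `w` for the seed `s`: the seed, followed by the hash bits. -/
def code (T : (Fin r → Bool) → Fin m → Fin L → Option α → ZMod 2) (s : Fin r → Bool)
    (w : List α) : Fin (r + m) → Bool :=
  Fin.append s fun j => decide (wordSum (T s j) w = 1)

theorem code_injective {T : (Fin r → Bool) → Fin m → Fin L → Option α → ZMod 2}
    {s s' : Fin r → Bool} {v w : List α} (h : code T s v = code T s' w) :
    s = s' ∧ ∀ j, wordSum (T s j) v = wordSum (T s j) w := by
  have hs : s = s' := by
    funext i
    simpa [code] using congrFun h (Fin.castAdd m i)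
  subst hs
  refine ⟨rfl, fun j => ?_⟩
  have := congrFun h (Fin.natAdd r j)
  by_contra hne
  rw [← Ne, zmod_two_ne_iff] at hne
  simp only [code, Fin.append_right] at this
  simp [this] at hne

open Classical in
/-- The encoder: the syndrome for the first good seed. -/
noncomputable def syndrome (M K : ℕ) (T : (Fin r → Bool) → Fin m → Fin L → Option α → ZMod 2) (w : List α) :
    Fin (r + m) → Bool := fun j =>
  (((Finset.univ : Finset (Fin r → Bool)).toList.find? fun s =>
    decide (Separates (M := M) K (T s) w)).map fun s => code T s w j).getD false

theorem exists_syndrome_eq {K : ℕ} {T : (Fin r → Bool) → Fin m → Fin L → Option α → ZMod 2}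
    {w : List α} (h : ∃ s, Separates (M := M) K (T s) w) :
    ∃ s, Separates (M := M) K (T s) w ∧ syndrome M K T w = code T s w := by
  classical
  obtain ⟨s, hs⟩ := h
  cases hf : (Finset.univ : Finset (Fin r → Bool)).toList.find? fun s =>
    decide (Separates (M := M) K (T s) w) with
  | none =>
    have := List.find?_eq_none.1 hf s (by simp)
    simp [hs] at this
  | some s' =>
    refine ⟨s', by simpa using List.find?_some hf, ?_⟩
    funext j
    rw [syndrome, hf]
    rfl

/-- The decoder: the first word obtained by `k` operations whose syndrome is as prescribed. -/
noncomputable def decodeWord [Fintype α] (M k : ℕ) (T : (Fin r → Bool) → Fin m → Fin L → Option α → ZMod 2)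
    (y : List α) (σ : Fin (r + m) → Bool) : Option (List α) :=
  ((Finset.univ : Finset (List.Vector (Op M α) k × (Fin r → Bool))).toList.find? fun p =>
    decide (∀ j, code T p.2 (applyOps p.1.toList y) j = σ j)).map
      fun p => applyOps p.1.toList y

theorem decodeWord_syndrome [Fintype α] [Nonempty α] {k : ℕ}
    {T : (Fin r → Bool) → Fin m → Fin L → Option α → ZMod 2} {x y : List α}
    (hT : ∃ s, Separates (M := M) (2 * k) (T s) x) (hxy : Edits k x y) (hM : x.length + k < M) :
    decodeWord M k T y (syndrome M (2 * k) T x) = some x := by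
  obtain ⟨s, hs, hsyn⟩ := exists_syndrome_eq hT
  rw [hsyn]
  obtain ⟨l, hl⟩ := hxy.exists_ops hM
  obtain ⟨l', hl'⟩ := hxy.exists_ops_symm hM
  rw [decodeWord]
  cases hf : (Finset.univ : Finset (List.Vector (Op M α) k × (Fin r → Bool))).toList.find?
    fun p => decide (∀ j, code T p.2 (applyOps p.1.toList y) j = code T s x j) with
  | none =>
    have := List.find?_eq_none.1 hf (l', s) (by simp)
    simp [hl'] at this
  | some p =>
    have hp : code T p.2 (applyOps p.1.toList y) = code T s x :=
      funext (by simpa using List.find?_some hf)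
    obtain ⟨hps, hj⟩ := code_injective hp
    rw [hps] at hj
    rw [Option.map_some, Option.some_inj]
    by_contra hne
    let v : List.Vector (Op M α) (2 * k) := ⟨l.toList ++ p.1.toList, by simp; omega⟩
    have hv : applyOps v.toList x = applyOps p.1.toList y := by
      rw [List.Vector.toList_mk, applyOps_append, hl]
    obtain ⟨j, hj'⟩ := hs v (by rwa [hv])
    exact hj' (by rw [hv]; exact hj j)

variable {D : Type*} {N : ℕ} {e : D → List.Vector Bool N} {A : Set (D → Bool)}
variable [Fintype α] [DecidableEq α] {w : D → List α}

theorem derivable_code (hA : symbolBits w ⊆ A)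
    (T : (Fin r → Bool) → Fin m → Fin L → Option α → ZMod 2) (s : Fin r → Bool)
    (l : List (Op M α)) (j : Fin (r + m)) :
    Derivable e A {fun d => code T s (applyOps l (w d)) j}
      (L * (Fintype.card α + 6) + 1) := by
  refine Fin.addCases (fun i => ?_) (fun i => ?_) j
  · simp only [code, Fin.append_left]
    exact (Derivable.const _).le (by omega)
  · simp only [code, Fin.append_right]
    exact derivable_wordSum hA l _

theorem derivable_syndrome {K : ℕ} (hA : symbolBits w ⊆ A)
    (T : (Fin r → Bool) → Fin m → Fin L → Option α → ZMod 2) (hL : ∀ d, (w d).length + K ≤ L)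
    (j : Fin (r + m)) :
    Derivable e A {fun d => syndrome M K T (w d) j}
      (2 ^ r * (2 * ((M * Fintype.card α * 4) ^ K *
        (L * (Fintype.card α + 1) * (2 * Fintype.card α + 11) +
          m * (2 * (L * (Fintype.card α + 6)) + 7) + 6) + 2) +
        (L * (Fintype.card α + 6) + 1) + 4) + 1) := by
  have := Derivable.find (e := e) (A := A) (Finset.univ : Finset (Fin r → Bool)).toList
    (fun s => derivable_separates (M := M) hA (T s) hL)
    (fun s => derivable_code hA T s ([] : List (Op M α)) j) (Derivable.const false)
  rw [Finset.length_toList, Finset.card_univ, Fintype.card_fun, Fintype.card_bool,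
    Fintype.card_fin] at this
  exact this

theorem derivable_decodeWord {k : ℕ} (hA : symbolBits w ⊆ A)
    (T : (Fin r → Bool) → Fin m → Fin L → Option α → ZMod 2) {σ : D → Fin (r + m) → Bool}
    (hσ : ∀ j, (fun d => σ d j) ∈ A) (i : ℕ) (P : Option α → Bool) :
    Derivable e A {fun d => P ((decodeWord M k T (w d) (σ d)).bind fun v => v[i]?)}
      ((M * Fintype.card α * 4) ^ k * 2 ^ r *
        (2 * ((r + m) * (L * (Fintype.card α + 6) + 8) + 2) + Fintype.card α + 6) + 1) := by
  have hc (p : List.Vector (Op M α) k × (Fin r → Bool)) : Derivable e A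
      {fun d => decide (∀ j, code T p.2 (applyOps p.1.toList (w d)) j = σ d j)}
      ((r + m) * (L * (Fintype.card α + 6) + 8) + 2) := by
    have := Derivable.forall (e := e) (A := A) (ι := Fin (r + m))
      (f := fun d => decide (∀ j, code T p.2 (applyOps p.1.toList (w d)) j = σ d j))
      (fun j => ((derivable_code hA T p.2 p.1.toList j).xor (.of_mem (hσ j))).not)
      (fun d => by simp)
    rw [Fintype.card_fin] at this
    exact this
  have := Derivable.find (e := e) (A := A)
    (Finset.univ : Finset (List.Vector (Op M α) k × (Fin r → Bool))).toList hc
    (fun p => derivable_symbol hA p.1.toList i P) (Derivable.const (P none))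
  rw [Finset.length_toList, Finset.card_univ, Fintype.card_prod, Fintype.card_fun,
    Fintype.card_bool, card_vector, Fintype.card_prod, Fintype.card_prod, Fintype.card_fin,
    Fintype.card_fin, Fintype.card_fin] at this
  refine this.mono subset_rfl ?_ (le_of_eq (by ring))
  rintro _ rfl
  funext d
  simp only [decodeWord]
  cases (Finset.univ : Finset (List.Vector (Op M α) k × (Fin r → Bool))).toList.find? fun p =>
    decide (∀ j, code T p.2 (applyOps p.1.toList (w d)) j = σ d j) <;> simp

end Code

/-! ### Binary representation of words -/

section Bits

variable {q : ℕ}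

theorem length_slotBits (o : Option (Fin q)) : (slotBits q o).length = 1 + Nat.clog 2 q := by
  cases o <;> simp [slotBits, add_comm]

theorem slotBits_injective : Function.Injective (slotBits q) := by
  have key : ∀ a b : Fin q, slotBits q (some a) = slotBits q (some b) → a = b := by
    intro a b h
    simp only [slotBits, List.cons.injEq, true_and] at h
    refine Fin.ext (Nat.eq_of_testBit_eq fun j => ?_)
    rcases lt_or_ge j (Nat.clog 2 q) with hj | hj
    · exact List.map_inj_left.1 h j (List.mem_range.2 hj)
    · have hq : q ≤ 2 ^ j := (Nat.le_pow_clog one_lt_two q).trans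
        (Nat.pow_le_pow_right two_pos hj)
      rw [Nat.testBit_lt_two_pow (a.2.trans_le hq), Nat.testBit_lt_two_pow (b.2.trans_le hq)]
  rintro (_ | a) (_ | b) h
  · rfl
  · simp [slotBits, add_comm 1, List.replicate_succ] at h
  · simp [slotBits, add_comm 1, List.replicate_succ] at h
  · rw [key a b h]

theorem wordBits_succ (L : ℕ) (y : List (Fin q)) :
    wordBits q (L + 1) y = wordBits q L y ++ slotBits q y[L]? := by
  simp [wordBits, List.range_succ]

theorem length_wordBits (L : ℕ) (y : List (Fin q)) :
    (wordBits q L y).length = L * (1 + Nat.clog 2 q) := by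
  induction L with
  | zero => simp [wordBits]
  | succ L ih => rw [wordBits_succ, List.length_append, ih, length_slotBits]; ring

theorem getElem?_wordBits {L i j : ℕ} (y : List (Fin q)) (hi : i < L)
    (hj : j < 1 + Nat.clog 2 q) :
    (wordBits q L y)[i * (1 + Nat.clog 2 q) + j]? = (slotBits q y[i]?)[j]? := by
  induction L with
  | zero => omega
  | succ L ih =>
    rw [wordBits_succ]
    rcases Nat.lt_succ_iff_lt_or_eq.1 hi with h | rfl
    · rw [List.getElem?_append_left, ih h]
      rw [length_wordBits]
      calc _ < (i + 1) * (1 + Nat.clog 2 q) := by rw [add_mul, one_mul]; omega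
        _ ≤ _ := Nat.mul_le_mul_right _ h
    · rw [List.getElem?_append_right (by rw [length_wordBits]; omega), length_wordBits,
        Nat.add_sub_cancel_left]

/-- The bits of a slot holding a symbol, as a function of the position. -/
def symbolBit (a : Fin q) (j : ℕ) : Bool := (slotBits q (some a))[j]?.getD false

theorem wordBits_ofFn {n : ℕ} (x : Fin n → Fin q) :
    wordBits q n (List.ofFn x) = (List.finRange n).flatMap fun i =>
      (List.finRange (1 + Nat.clog 2 q)).map fun j : Fin (1 + Nat.clog 2 q) => symbolBit (x i) j := by
  have h1 : ∀ a : Fin q, slotBits q (some a) =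
      (List.finRange (1 + Nat.clog 2 q)).map fun j : Fin (1 + Nat.clog 2 q) => symbolBit a j := by
    intro a
    refine List.ext_getElem (by simp [length_slotBits]) fun j h _ => ?_
    simp [symbolBit, List.getElem?_eq_getElem h]
  simp only [← h1, wordBits]
  rw [← List.map_coe_finRange_eq_range, List.flatMap_map]
  refine List.flatMap_congr fun i _ => ?_
  simp

variable {D : Type*} {N : ℕ}

/-- The functions read off from a single input bit. -/
def inputBits (e : D → List.Vector Bool N) : Set (D → Bool) :=
  {b | ∃ i : ℕ, ∀ d, (e d).toList[i]? = some (b d)}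

theorem derivable_symbolBits {e : D → List.Vector Bool N} {w : D → List (Fin q)} {L : ℕ}
    (hw : ∀ d, (w d).length ≤ L) (he : ∀ d, wordBits q L (w d) <+: (e d).toList) :
    Derivable e (inputBits e) (symbolBits w)
      (L * (q + 1) * ((1 + Nat.clog 2 q) * 8 + 2) + 2) := by
  have hbit (i : Fin L) (j : Fin (1 + Nat.clog 2 q)) :
      (fun d => (slotBits q (w d)[(i : ℕ)]?)[(j : ℕ)]?.getD false) ∈ inputBits e := by
    refine ⟨i * (1 + Nat.clog 2 q) + j, fun d => ?_⟩
    obtain ⟨t, ht⟩ := he d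
    have hlt : (j : ℕ) < (slotBits q (w d)[(i : ℕ)]?).length := by rw [length_slotBits]; exact j.2
    have h := getElem?_wordBits (w d) i.2 j.2
    rw [List.getElem?_eq_getElem hlt] at h
    rw [← ht, List.getElem?_append_left (List.getElem?_eq_some_iff.1 h).1, h]
    simp [List.getElem?_eq_getElem hlt]
  have hsym (io : Fin L × Option (Fin q)) : Derivable e (inputBits e)
      {fun d => decide ((w d)[(io.1 : ℕ)]? = io.2)} ((1 + Nat.clog 2 q) * 8 + 2) := by
    have := Derivable.forall (e := e) (A := inputBits e) (ι := Fin (1 + Nat.clog 2 q))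
      (f := fun d => decide ((w d)[(io.1 : ℕ)]? = io.2))
      (fun j => ((Derivable.of_mem (hbit io.1 j)).xor
        (Derivable.const ((slotBits q io.2)[j]?.getD false))).not) ?_
    · rw [Fintype.card_fin] at this
      exact this
    intro d
    rw [decide_eq_true_iff]
    constructor
    · intro h j; simp [h]
    · intro h
      refine slotBits_injective (List.ext_getElem (by simp only [length_slotBits]) ?_)
      intro j h1 h2
      have := h ⟨j, by rwa [length_slotBits] at h1⟩
      simpa [List.getElem?_eq_getElem h2, List.getElem?_eq_getElem h1] using this
  refine ((Derivable.range hsym).union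
    ((Derivable.const true).union (Derivable.const false))).mono subset_rfl ?_
    (by simp)
  rintro _ ⟨i, o, rfl⟩
  rcases lt_or_ge i L with hi | hi
  · exact .inl ⟨(⟨i, hi⟩, o), rfl⟩
  · right
    have : ∀ d, (w d)[i]? = none := fun d => List.getElem?_eq_none ((hw d).trans hi)
    simp only [this]
    cases o
    · left; simp
    · right; simp

end Bits

end Reading

section Final

/-! ### Encoder and decoder circuits -/

/-- A bound for the size of a circuit that computes the symbol indicators of a word in `L` slots. -/
def symbolBitsCost (q L : ℕ) : ℕ := L * (q + 1) * ((1 + Nat.clog 2 q) * 8 + 2) + 2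

/-- A bound for the size of the encoder circuit. -/
def encoderCost (q n k r m : ℕ) : ℕ :=
  symbolBitsCost q n + (r + m) * (2 ^ r * (2 * (((n + 2 * k + 1) * q * 4) ^ (2 * k) *
    ((n + 2 * k + 1) * (q + 1) * (2 * q + 11) +
      m * (2 * ((n + 2 * k + 1) * (q + 6)) + 7) + 6) + 2) +
    ((n + 2 * k + 1) * (q + 6) + 1) + 4) + 1)

/-- A bound for the size of the decoder circuit. -/
def decoderCost (q n k r m : ℕ) : ℕ :=
  symbolBitsCost q (n + k) + n * (1 + Nat.clog 2 q) *
    (((n + 2 * k + 1) * q * 4) ^ k * 2 ^ r *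
      (2 * ((r + m) * ((n + 2 * k + 1) * (q + 6) + 8) + 2) + q + 6) + 1)

variable {q n k r m : ℕ}

theorem exists_encoder_circuit
    (T : (Fin r → Bool) → Fin m → Fin (n + 2 * k + 1) → Option (Fin q) → ZMod 2) :
    ∃ C : Circuit, C.size ≤ encoderCost q n k r m ∧ ∀ x : Fin n → Fin q,
      C.eval (wordBits q n (List.ofFn x)) =
        List.ofFn (syndrome (n + 2 * k + 1) (2 * k) T (List.ofFn x)) := by
  let e : (Fin n → Fin q) → List.Vector Bool (n * (1 + Nat.clog 2 q)) := fun x =>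
    ⟨wordBits q n (List.ofFn x), length_wordBits _ _⟩
  have h1 : Derivable e (inputBits e) (symbolBits fun x => List.ofFn x) (symbolBitsCost q n) :=
    derivable_symbolBits (fun x => by simp) fun x => List.prefix_rfl
  have h2 := Derivable.range fun j : Fin (r + m) =>
    derivable_syndrome (e := e) (w := fun x : Fin n → Fin q => List.ofFn x)
      (M := n + 2 * k + 1) (K := 2 * k) subset_rfl T
      (fun x => by rw [List.length_ofFn]; omega) j
  have h3 := h1.trans h2
  rw [Fintype.card_fin, Fintype.card_fin] at h3
  exact h3.exists_circuit
    (out := fun x => List.ofFn (syndrome (n + 2 * k + 1) (2 * k) T (List.ofFn x)))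
    (fun b hb => hb)
    (List.ofFn fun j x => syndrome (n + 2 * k + 1) (2 * k) T (List.ofFn x) j)
    (fun b hb => by rwa [List.mem_ofFn] at hb) (fun x => by rw [List.map_ofFn]; rfl)

/-- The decoder with values in words of length `n`; missing symbols are filled with `a`. -/
noncomputable def decoder (a : Fin q)
    (T : (Fin r → Bool) → Fin m → Fin (n + 2 * k + 1) → Option (Fin q) → ZMod 2)
    (y : List (Fin q)) (s : Fin (r + m) → Bool) : Fin n → Fin q := fun i =>
  ((decodeWord (n + 2 * k + 1) k T y s).bind fun v => v[(i : ℕ)]?).getD a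

theorem decoder_syndrome (a : Fin q)
    {T : (Fin r → Bool) → Fin m → Fin (n + 2 * k + 1) → Option (Fin q) → ZMod 2}
    {x : Fin n → Fin q} {y : List (Fin q)}
    (hT : ∃ s, Separates (M := n + 2 * k + 1) (2 * k) (T s) (List.ofFn x))
    (hxy : Edits k (List.ofFn x) y) :
    decoder a T y (syndrome (n + 2 * k + 1) (2 * k) T (List.ofFn x)) = x := by
  have : Nonempty (Fin q) := ⟨a⟩
  funext i
  rw [decoder, decodeWord_syndrome hT hxy (by rw [List.length_ofFn]; omega)]
  simp

theorem exists_decoder_circuit (a : Fin q) (ℓ : ℕ)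
    (T : (Fin r → Bool) → Fin m → Fin (n + 2 * k + 1) → Option (Fin q) → ZMod 2) :
    ∃ C : Circuit, C.size ≤ decoderCost q n k r m ∧
      ∀ (y : List (Fin q)) (s : Fin (r + m) → Bool), y.length ≤ n + k →
        C.eval (wordBits q (n + k) y ++ List.ofFn s) =
          (List.ofFn fun _ : Fin ℓ => wordBits q n (List.ofFn (decoder a T y s))).flatten := by
  let D := {y : List (Fin q) // y.length ≤ n + k} × (Fin (r + m) → Bool)
  let e : D → List.Vector Bool ((n + k) * (1 + Nat.clog 2 q) + (r + m)) := fun d =>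
    ⟨wordBits q (n + k) d.1.1 ++ List.ofFn d.2, by
      rw [List.length_append, length_wordBits, List.length_ofFn]⟩
  let w : D → List (Fin q) := fun d => d.1.1
  have h1 : Derivable e (inputBits e) (symbolBits w ∪ inputBits e) (symbolBitsCost q (n + k) + 0) :=
    (derivable_symbolBits (fun d => d.1.2) fun d => List.prefix_append _ _).union
      (.of_subset subset_rfl)
  have hs (j : Fin (r + m)) : (fun d : D => d.2 j) ∈ inputBits e := by
    refine ⟨(n + k) * (1 + Nat.clog 2 q) + j, fun d => ?_⟩
    change (wordBits q (n + k) d.1.1 ++ List.ofFn d.2)[_]? = _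
    rw [List.getElem?_append_right (by rw [length_wordBits]; omega), length_wordBits,
      Nat.add_sub_cancel_left]
    simp
  let bit : Fin n × Fin (1 + Nat.clog 2 q) → D → Bool := fun ij d =>
    symbolBit (decoder a T d.1.1 d.2 ij.1) ij.2
  have h2 := Derivable.range (b := bit) fun ij =>
    derivable_decodeWord (e := e) (w := w) (A := symbolBits w ∪ inputBits e)
      (σ := fun d => d.2) (M := n + 2 * k + 1) (k := k)
      Set.subset_union_left T (fun j => .inr (hs j)) ij.1 fun o => symbolBit (o.getD a) ij.2
  have h3 := h1.trans h2
  rw [Fintype.card_prod, Fintype.card_fin, Fintype.card_fin, Fintype.card_fin] at h3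
  obtain ⟨C, hC, h⟩ := h3.exists_circuit
    (out := fun d => (List.ofFn fun _ : Fin ℓ =>
      wordBits q n (List.ofFn (decoder a T d.1.1 d.2))).flatten)
    (fun b hb => hb)
    (List.ofFn fun _ : Fin ℓ => (List.finRange n).flatMap fun i =>
      (List.finRange (1 + Nat.clog 2 q)).map fun j => bit (i, j)).flatten
    (fun b hb => by
      obtain ⟨l, hl, hb⟩ := List.mem_flatten.1 hb
      obtain ⟨_, rfl⟩ := List.mem_ofFn.1 hl
      obtain ⟨i, _, hb⟩ := List.mem_flatMap.1 hb
      obtain ⟨j, _, rfl⟩ := List.mem_map.1 hb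
      exact ⟨(i, j), rfl⟩)
    (fun d => by
      rw [List.map_flatten, List.map_ofFn]
      simp only [wordBits_ofFn, Function.comp_def, List.map_flatMap, List.map_map]
      rfl)
  exact ⟨C, hC, fun y s hy => h (⟨y, hy⟩, s)⟩

/-! ### Polynomial bounds -/

/-- Bounded by a polynomial with natural coefficients. -/
def PolyBound (f : ℕ → ℕ) : Prop := ∃ P : Polynomial ℕ, ∀ n, f n ≤ P.eval n

namespace PolyBound

variable {f g : ℕ → ℕ}

theorem mono (hg : PolyBound g) (h : ∀ n, f n ≤ g n) : PolyBound f :=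
  let ⟨P, hP⟩ := hg
  ⟨P, fun n => (h n).trans (hP n)⟩

theorem const (c : ℕ) : PolyBound fun _ => c := ⟨.C c, by simp⟩

theorem id : PolyBound fun n => n := ⟨.X, by simp⟩

theorem add (hf : PolyBound f) (hg : PolyBound g) : PolyBound fun n => f n + g n :=
  let ⟨P, hP⟩ := hf
  let ⟨Q, hQ⟩ := hg
  ⟨P + Q, fun n => by simpa using Nat.add_le_add (hP n) (hQ n)⟩

theorem mul (hf : PolyBound f) (hg : PolyBound g) : PolyBound fun n => f n * g n :=
  let ⟨P, hP⟩ := hf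
  let ⟨Q, hQ⟩ := hg
  ⟨P * Q, fun n => by simpa using Nat.mul_le_mul (hP n) (hQ n)⟩

theorem pow (hf : PolyBound f) (c : ℕ) : PolyBound fun n => f n ^ c :=
  let ⟨P, hP⟩ := hf
  ⟨P ^ c, fun n => by simpa using Nat.pow_le_pow_left (hP n) c⟩

theorem clog (hf : PolyBound f) : PolyBound fun n => Nat.clog 2 (f n) :=
  hf.mono fun _ => Nat.clog_le_of_le_pow Nat.lt_two_pow_self.le

theorem symbolBitsCost {q L : ℕ → ℕ} (hq : PolyBound q) (hL : PolyBound L) :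
    PolyBound fun n => symbolBitsCost (q n) (L n) :=
  ((hL.mul (hq.add (const 1))).mul
    (((((const 1).add hq.clog).mul (const 8)).add (const 2)))).add (const 2)

theorem encoderCost {q r m : ℕ → ℕ} (k : ℕ) (hq : PolyBound q) (hr : PolyBound fun n => 2 ^ r n)
    (hm : PolyBound m) : PolyBound fun n => encoderCost (q n) n k (r n) (m n) := by
  have hr' : PolyBound r := hr.mono fun n => Nat.lt_two_pow_self.le
  have hL : PolyBound fun n => n + 2 * k + 1 := (id.add (const _)).add (const 1)
  unfold EditCode.encoderCost
  exact (hq.symbolBitsCost id).add <| (hr'.add hm).mul <|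
    (hr.mul <| (((const 2).mul <| ((((hL.mul hq).mul (const 4)).pow _).mul <|
      (((hL.mul (hq.add (const 1))).mul (((const 2).mul hq).add (const 11))).add <|
        hm.mul (((const 2).mul (hL.mul (hq.add (const 6)))).add (const 7))).add
          (const 6)).add (const 2)).add
      ((hL.mul (hq.add (const 6))).add (const 1))).add (const 4)).add (const 1)

theorem decoderCost {q r m : ℕ → ℕ} (k : ℕ) (hq : PolyBound q) (hr : PolyBound fun n => 2 ^ r n)
    (hm : PolyBound m) : PolyBound fun n => decoderCost (q n) n k (r n) (m n) := by
  have hr' : PolyBound r := hr.mono fun n => Nat.lt_two_pow_self.le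
  have hL : PolyBound fun n => n + 2 * k + 1 := (id.add (const _)).add (const 1)
  unfold EditCode.decoderCost
  exact (hq.symbolBitsCost (id.add (const k))).add <|
    (id.mul ((const 1).add hq.clog)).mul <|
    (((((hL.mul hq).mul (const 4)).pow k).mul hr).mul <|
      (((const 2).mul (((hr'.add hm).mul ((hL.mul (hq.add (const 6))).add (const 8))).add
        (const 2))).add hq).add (const 6)).add (const 1)

end PolyBound

/-! ### Parameters -/

/-- The number of seed bits. -/
def seedLength (k q n : ℕ) : ℕ := if k = 0 then 0 else Nat.clog 2 (n * q + 1)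

/-- The number of hash bits. -/
def hashLength (k q n : ℕ) : ℕ :=
  if k = 0 then 0 else Nat.clog 2 (2 * ((n + 2 * k + 1) * (q * 4)) ^ (2 * k))

theorem two_pow_clog_le (a : ℕ) (ha : 1 ≤ a) : 2 ^ Nat.clog 2 a ≤ 2 * a := by
  rcases ha.eq_or_lt with rfl | h
  · simp
  · have h0 : 0 < Nat.clog 2 a := Nat.clog_pos one_lt_two h
    have h1 := Nat.pow_pred_clog_lt_self one_lt_two h
    rw [← Nat.succ_pred_eq_of_pos h0, pow_succ]
    omega

theorem polyBound_two_pow_seedLength (k : ℕ) {q : ℕ → ℕ} (hq : PolyBound q) :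
    PolyBound fun n => 2 ^ seedLength k (q n) n := by
  refine ((PolyBound.const 2).mul ((PolyBound.id.mul hq).add (.const 1))).mono fun n => ?_
  rw [seedLength]
  split
  · rw [pow_zero]; omega
  · exact two_pow_clog_le _ (by omega)

theorem polyBound_hashLength (k : ℕ) {q : ℕ → ℕ} (hq : PolyBound q) :
    PolyBound fun n => hashLength k (q n) n := by
  have h : PolyBound fun n => 2 * ((n + 2 * k + 1) * (q n * 4)) ^ (2 * k) :=
    (PolyBound.const 2).mul ((((PolyBound.id.add (.const _)).add (.const 1)).mul
      (hq.mul (.const 4))).pow _)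
  refine h.clog.mono fun n => ?_
  rw [hashLength]
  split
  · omega
  · exact le_rfl

theorem exists_tables (k q n : ℕ) :
    ∃ T : (Fin (seedLength k q n) → Bool) → Fin (hashLength k q n) → Fin (n + 2 * k + 1) →
        Option (Fin q) → ZMod 2,
      ∀ x : Fin n → Fin q, ∃ s, Separates (M := n + 2 * k + 1) (2 * k) (T s) (List.ofFn x) := by
  rcases Nat.eq_zero_or_pos k with rfl | hk
  · refine ⟨fun _ _ _ _ => 0, fun x => ⟨fun _ => false, fun p hp => (hp ?_).elim⟩⟩
    have : p.toList = [] := List.eq_nil_of_length_eq_zero (by simp)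
    rw [this]
    rfl
  · refine exists_separating_family (by omega) ?_ ?_
    · rw [hashLength, if_neg hk.ne']
      have := Nat.le_pow_clog one_lt_two (2 * ((n + 2 * k + 1) * (q * 4)) ^ (2 * k))
      simpa using this
    · have h1 : n * q < 2 ^ seedLength k q n := by
        rw [seedLength, if_neg hk.ne']
        exact Nat.le_pow_clog one_lt_two (n * q + 1)
      calc Fintype.card (Fin q) ^ n ≤ (2 ^ q) ^ n := by
            rw [Fintype.card_fin]
            exact Nat.pow_le_pow_left Nat.lt_two_pow_self.le n
        _ = 2 ^ (n * q) := by rw [← pow_mul, mul_comm]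
        _ < _ := by simpa using Nat.pow_lt_pow_right one_lt_two h1

theorem clog_two_le_logb {a : ℕ} (ha : 1 ≤ a) : (Nat.clog 2 a : ℝ) ≤ 1 + Real.logb 2 a := by
  have h : ((2 ^ Nat.clog 2 a : ℕ) : ℝ) ≤ ((2 * a : ℕ) : ℝ) :=
    Nat.cast_le.2 (two_pow_clog_le a ha)
  push_cast at h
  have ha' : (a : ℝ) ≠ 0 := by positivity
  have := Real.logb_le_logb_of_le one_lt_two (by positivity) h
  rwa [Real.logb_pow, Real.logb_self_eq_one one_lt_two, mul_one,
    Real.logb_mul two_ne_zero ha', Real.logb_self_eq_one one_lt_two] at this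

theorem seedLength_le {k q n : ℕ} (hk : 1 ≤ k) (hq : 1 ≤ q) (hn : 3 ≤ n) :
    (seedLength k q n : ℝ) ≤ 2 + Real.logb 2 n + Real.logb 2 q := by
  have hq' : (q : ℝ) ≠ 0 := by positivity
  have hn' : (n : ℝ) ≠ 0 := by positivity
  rw [seedLength, if_neg (by omega)]
  refine (Nat.cast_le.2 (Nat.clog_mono_right 2 (?_ : n * q + 1 ≤ 2 * (n * q)))).trans ?_
  · have : 1 ≤ n * q := Nat.mul_pos (by omega) hq
    omega
  · refine (clog_two_le_logb (Nat.mul_pos two_pos (Nat.mul_pos (by omega) hq))).trans (le_of_eq ?_)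
    push_cast
    rw [Real.logb_mul two_ne_zero (mul_ne_zero hn' hq'), Real.logb_mul hn' hq',
      Real.logb_self_eq_one one_lt_two]
    ring

theorem hashLength_le {k q n : ℕ} (hk : 1 ≤ k) (hq : 1 ≤ q) (hn : 3 ≤ n) :
    (hashLength k q n : ℝ) ≤ 2 + 2 * k * Real.logb 2 (8 * k + 8) +
      2 * k * Real.logb 2 n + 2 * k * Real.logb 2 q := by
  have hq' : (q : ℝ) ≠ 0 := by positivity
  have hn' : (n : ℝ) ≠ 0 := by positivity
  have hk' : (8 * k + 8 : ℝ) ≠ 0 := by positivity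
  have hle : (n + 2 * k + 1) * (q * 4) ≤ (8 * k + 8) * n * q := by
    calc (n + 2 * k + 1) * (q * 4) = (4 * n + (8 * k + 4) * 1) * q := by ring
      _ ≤ (4 * n + (8 * k + 4) * n) * q := by gcongr; omega
      _ = _ := by ring
  rw [hashLength, if_neg (by omega)]
  refine (Nat.cast_le.2 (Nat.clog_mono_right 2
    (Nat.mul_le_mul_left 2 (Nat.pow_le_pow_left hle (2 * k))))).trans ?_
  refine (clog_two_le_logb (Nat.mul_pos two_pos (Nat.pow_pos
    (Nat.mul_pos (Nat.mul_pos (by omega) (by omega)) hq)))).trans (le_of_eq ?_)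
  push_cast
  rw [Real.logb_mul two_ne_zero (pow_ne_zero _ (mul_ne_zero (mul_ne_zero hk' hn') hq')),
    Real.logb_pow, Real.logb_mul (mul_ne_zero hk' hn') hq', Real.logb_mul hk' hn',
    Real.logb_self_eq_one one_lt_two]
  push_cast
  ring

theorem logb_logb_three_pos : 0 < Real.logb 2 (Real.logb 2 3) := by
  refine Real.logb_pos one_lt_two ?_
  rw [Real.lt_logb_iff_rpow_lt one_lt_two (by norm_num)]
  norm_num

theorem exists_length_bound (k ℓ : ℕ) : ∃ C : ℝ, ∀ q n : ℕ, 1 ≤ q → 3 ≤ n →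
    ((seedLength k q n + hashLength k q n : ℕ) : ℝ) ≤ (3 + 1 / (ℓ : ℝ)) * k * Real.logb 2 n
      + (3 + 1 / (ℓ : ℝ)) * k * Real.logb 2 q + C * Real.logb 2 (Real.logb 2 n) := by
  rcases Nat.eq_zero_or_pos k with rfl | hk
  · exact ⟨0, fun q n _ _ => by simp [seedLength, hashLength]⟩
  set c : ℝ := 4 + 2 * k * Real.logb 2 (8 * k + 8) with hc
  have hc0 : 0 ≤ c := by
    have : 0 ≤ Real.logb 2 (8 * k + 8) :=
      Real.logb_nonneg one_lt_two (by have := Nat.cast_nonneg (α := ℝ) k; linarith)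
    positivity
  refine ⟨c / Real.logb 2 (Real.logb 2 3), fun q n hq hn => ?_⟩
  have h3 := logb_logb_three_pos
  have hn3 : (3 : ℝ) ≤ n := by exact_mod_cast hn
  have hlog : Real.logb 2 (Real.logb 2 3) ≤ Real.logb 2 (Real.logb 2 n) :=
    Real.logb_le_logb_of_le one_lt_two (Real.logb_pos one_lt_two (by norm_num))
      (Real.logb_le_logb_of_le one_lt_two (by norm_num) hn3)
  have hcn : c ≤ c / Real.logb 2 (Real.logb 2 3) * Real.logb 2 (Real.logb 2 n) := by
    calc c = c / Real.logb 2 (Real.logb 2 3) * Real.logb 2 (Real.logb 2 3) := by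
          field_simp
      _ ≤ _ := mul_le_mul_of_nonneg_left hlog (by positivity)
  have ha : 0 ≤ Real.logb 2 n := Real.logb_nonneg one_lt_two (by linarith)
  have hb : 0 ≤ Real.logb 2 q := Real.logb_nonneg one_lt_two (by exact_mod_cast hq)
  have hk1 : (1 : ℝ) ≤ k := by exact_mod_cast hk
  have hcoef : 2 * (k : ℝ) + 1 ≤ (3 + 1 / (ℓ : ℝ)) * k := by
    have : 0 ≤ 1 / (ℓ : ℝ) * k := by positivity
    linarith
  have h1 := seedLength_le hk hq hn
  have h2 := hashLength_le hk hq hn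
  have h4 := mul_le_mul_of_nonneg_right hcoef ha
  have h5 := mul_le_mul_of_nonneg_right hcoef hb
  push_cast
  linarith

end Final

end EditCode


theorem mainTheorem4 (k ℓ : ℕ) (hℓ : 1 ≤ ℓ) (q : ℕ → ℕ) (hq : ∀ n, 1 ≤ q n)
    (hpoly : ∃ P : Polynomial ℕ, ∀ n, q n ≤ P.eval n) :
    ∃ (C : ℝ) (T : Polynomial ℕ), ∀ n : ℕ, 3 ≤ n →
      ∃ (ρ : ℕ) (Φ : (Fin n → Fin (q n)) → (Fin ρ → Bool))
        (Dec : List (Fin (q n)) → (Fin ρ → Bool) → Fin ℓ → (Fin n → Fin (q n)))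
        (enc dec : EditCode.Circuit),
        -- the length of the syndrome
        (ρ : ℝ) ≤ (3 + 1 / (ℓ : ℝ)) * k * Real.logb 2 n
            + (3 + 1 / (ℓ : ℝ)) * k * Real.logb 2 (q n)
            + C * Real.logb 2 (Real.logb 2 n) ∧
        -- correction of `k` edits with list size `ℓ`
        (∀ (x : Fin n → Fin (q n)) (y : List (Fin (q n))),
          EditCode.Edits k (List.ofFn x) y → ∃ i, Dec y (Φ x) i = x) ∧
        -- the syndrome is computed with polynomially many operations
        enc.size ≤ T.eval n ∧
        (∀ x : Fin n → Fin (q n),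
          enc.eval (EditCode.wordBits (q n) n (List.ofFn x)) = List.ofFn (Φ x)) ∧
        -- the list is computed with polynomially many operations
        dec.size ≤ T.eval n ∧
        (∀ (y : List (Fin (q n))) (s : Fin ρ → Bool), y.length ≤ n + k →
          dec.eval (EditCode.wordBits (q n) (n + k) y ++ List.ofFn s) =
            (List.ofFn fun i : Fin ℓ =>
              EditCode.wordBits (q n) n (List.ofFn (Dec y s i))).flatten) := by
  open EditCode in
  obtain ⟨C, hC⟩ := exists_length_bound k ℓ
  have hr := polyBound_two_pow_seedLength k hpoly
  have hm := polyBound_hashLength k hpoly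
  obtain ⟨P, hP⟩ := PolyBound.encoderCost k hpoly hr hm
  obtain ⟨Q, hQ⟩ := PolyBound.decoderCost k hpoly hr hm
  refine ⟨C, P + Q, fun n hn => ?_⟩
  obtain ⟨T, hT⟩ := exists_tables k (q n) n
  obtain ⟨enc, henc, henc'⟩ := exists_encoder_circuit T
  obtain ⟨dec, hdec, hdec'⟩ := exists_decoder_circuit ⟨0, hq n⟩ ℓ T
  rw [Polynomial.eval_add]
  exact ⟨seedLength k (q n) n + hashLength k (q n) n,
    fun x => syndrome (n + 2 * k + 1) (2 * k) T (List.ofFn x),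
    fun y s _ => decoder ⟨0, hq n⟩ T y s, enc, dec, hC (q n) n (hq n) hn,
    fun x y hxy => ⟨⟨0, hℓ⟩, decoder_syndrome _ (hT x) hxy⟩,
    (henc.trans (hP n)).trans (Nat.le_add_right _ _), henc',
    (hdec.trans (hQ n)).trans (Nat.le_add_left _ _), hdec'⟩
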